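/- Let $X$ be a complete separable metric space with its Borel $\sigma$-field, and let $\rho$ be a measure on $X$ that is finite on bounded Borel sets, diffuse ($\rho(\{x\})=0$ for every $x\in X$) and infinite ($\rho(X)=\infty$). A locally finite point measure is a measure on $X$ taking values in $\{0,1,2,\dots\}$ on bounded Borel sets. For $z\in(0,1)$ and a measure $\sigma$ finite on bounded sets, the Pólya sum process $\mathrm{Poy}_{z,\sigma}$ is the law $\mathsf P$ of a point process on $X$ (a probability measure concentrated on the locally finite point measures) such that $$\iint h(x,\mu)\,\mu(dx)\,\mathsf P(d\mu)=\iint h(x,\mu+\delta_x)\,z(\sigma+\mu)(dx)\,\mathsf P(d\mu)$$ for all measurable $h\ge 0$. Let $(Y_t)_{0\le t<1}$ be the Markov process of locally finite point measures with increasing, vaguely càdlàg paths, such that $Y_0=0$ and, for $0\le s<t<1$, the conditional law of $Y_t$ given $(Y_r)_{r\le s}$ is the law of $Y_s+\mu$ with $\mu\sim\mathrm{Poy}_{\frac{t-s}{1-s},\,\rho+Y_s}$. For a bounded Borel set $B$ and an integer $j\ge1$ let $U_{B,t}(j)$ be the number of points $x\in B$ with $Y_t(\{x\})=j$, and, if $\rho(B)>0$,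 let $$Z_{B,t}(j)=\frac{U_{B,t}(j)-t^j\rho(B)/j}{\sqrt{\rho(B)}} .$$ Let $(B_n)_n$ be an increasing sequence of bounded Borel sets with $\bigcup_n B_n=X$ (so that $\rho(B_n)>0$ for all large $n$), and let $t\in(0,1)$. Then, as $n\to\infty$, for each $j\ge1$, $Z_{B_n,t}(j)$ converges weakly to an $\mathcal N(0,t^j/j)$-distributed random variable $Z_t(j)$. Moreover, the limits $Z_t(1),Z_t(2),\dots$ are independent, that is, the sequence $(Z_{B_n,t}(j))_{j\ge1}$ converges weakly in $\mathbb R^{\mathbb N}$ (product topology) to a sequence $(Z_t(j))_{j\ge1}$ of independent random variables with these laws. -/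

import Mathlib

open MeasureTheory ProbabilityTheory Filter Topology
open scoped ENNReal NNReal BoundedContinuousFunction

noncomputable section

/-- A measure which is finite on bounded sets ("locally finite"). -/
def IsBoundedlyFinite {X : Type*} [MetricSpace X] [MeasurableSpace X] (μ : Measure X) : Prop :=
  ∀ B : Set X, MeasurableSet B → Bornology.IsBounded B → μ B < ∞

/-- A locally finite point measure: its values on bounded Borel sets are natural numbers. -/
def IsPointMeasure {X : Type*} [MetricSpace X] [MeasurableSpace X] (μ : Measure X) : Prop :=
  ∀ B : Set X, MeasurableSet B → Bornology.IsBounded B → ∃ n : ℕ, μ B = n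

/-- `P` is (the law of) a point process on `X`: a probability measure on the space of measures,
with the σ-field generated by the evaluations, concentrated on locally finite point measures. -/
structure IsPointProcess {X : Type*} [MetricSpace X] [MeasurableSpace X]
    (P : Measure (Measure X)) : Prop where
  isProbabilityMeasure : IsProbabilityMeasure P
  ae_isPointMeasure : ∀ᵐ μ ∂P, IsPointMeasure μ

/-- `P` is a Papangelou process with Papangelou kernel `π`: the Campbell measure
`h ↦ ∬ h(x, μ) μ(dx) P(dμ)` equals `h ↦ ∬ h(x, μ + δ_x) π(μ, dx) P(dμ)`. -/
structure IsPapangelouProcess {X : Type*} [MetricSpace X] [MeasurableSpace X]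
    (π : Measure X → Measure X) (P : Measure (Measure X)) : Prop
    extends IsPointProcess P where
  campbell : ∀ h : X × Measure X → ℝ≥0∞, Measurable h →
    ∫⁻ μ, ∫⁻ x, h (x, μ) ∂μ ∂P = ∫⁻ μ, ∫⁻ x, h (x, μ + Measure.dirac x) ∂(π μ) ∂P

/-- `P` is the Pólya sum process with parameters `z` and `ρ`, i.e. the Papangelou process with
kernel `π(μ, ·) = z (ρ + μ)`. -/
def IsPolyaSumProcess {X : Type*} [MetricSpace X] [MeasurableSpace X]
    (z : ℝ) (ρ : Measure X) (P : Measure (Measure X)) : Prop :=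
  IsPapangelouProcess (fun μ => ENNReal.ofReal z • (ρ + μ)) P

/-- Vague convergence of measures: convergence of the integrals of all non-negative bounded
continuous functions with bounded support. -/
def VagueTendsto {X ι : Type*} [MetricSpace X] [MeasurableSpace X]
    (μs : ι → Measure X) (l : Filter ι) (μ : Measure X) : Prop :=
  ∀ f : X →ᵇ ℝ≥0, Bornology.IsBounded (Function.support f) →
    Tendsto (fun i => ∫⁻ x, f x ∂(μs i)) l (𝓝 (∫⁻ x, f x ∂μ))

/-- The path space: vaguely càdlàg, increasing paths `[0, 1) → M` of locally finite point
measures. -/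
structure IsIncreasingCadlagPath {X : Type*} [MetricSpace X] [MeasurableSpace X]
    (w : Set.Ico (0 : ℝ) 1 → Measure X) : Prop where
  isPointMeasure : ∀ t, IsPointMeasure (w t)
  mono : Monotone w
  right_cont : ∀ t, VagueTendsto w (𝓝[>] t) (w t)
  left_lim : ∀ t, ∃ ν : Measure X, IsPointMeasure ν ∧ VagueTendsto w (𝓝[<] t) ν

/-- The σ-field generated by the process up to time `s`. -/
abbrev pastSigma {X Ω : Type*} [MeasurableSpace X]
    (Y : Set.Ico (0 : ℝ) 1 → Ω → Measure X) (s : Set.Ico (0 : ℝ) 1) : MeasurableSpace Ω :=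
  ⨆ r : Set.Iic s, MeasurableSpace.comap (Y r) inferInstance

/-- `Y` is the spatial Chinese-restaurant-like process driven by `ρ`: its paths are increasing and
càdlàg, `Y_0 = 0`, and it is a Markov process such that, given the past up to time `s`, the
conditional law of `Y_t` is that of `Y_s + μ`, where `μ` is a Pólya sum process with parameters
`(t - s) / (1 - s)` and `ρ + Y_s`. -/
structure IsSpatialCRP {X Ω : Type*} [MetricSpace X] [MeasurableSpace X] [MeasurableSpace Ω]
    (ρ : Measure X) (P : Measure Ω) (Y : Set.Ico (0 : ℝ) 1 → Ω → Measure X) : Prop where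
  measurable : ∀ t, Measurable (Y t)
  path : ∀ ω, IsIncreasingCadlagPath (fun t => Y t ω)
  init : ∀ᵐ ω ∂P, Y 0 ω = 0
  markov : ∀ s t : Set.Ico (0 : ℝ) 1, s < t →
    ∃ κ : Kernel (Measure X) (Measure X),
      (∀ ν : Measure X, IsPointMeasure ν →
        IsPolyaSumProcess (((t : ℝ) - s) / (1 - s)) (ρ + ν) (κ ν)) ∧
      ∀ A : Set Ω, MeasurableSet[pastSigma Y s] A →
        ∀ φ : Measure X → ℝ≥0∞, Measurable φ →
          ∫⁻ ω in A, φ (Y t ω) ∂P = ∫⁻ ω in A, ∫⁻ μ, φ (Y s ω + μ) ∂(κ (Y s ω)) ∂P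

/-- `U_B(j)`: the number of points of multiplicity `j ≥ 1` of the configuration `μ` in `B`. -/
def multCount {X : Type*} [MeasurableSpace X] (B : Set X) (μ : Measure X) (j : ℕ+) : ℕ :=
  Set.ncard {x | x ∈ B ∧ μ {x} = ((j : ℕ) : ℝ≥0∞)}

/-- `Z_{B,t}(j) = (U_B(j) - t^j ρ(B) / j) / √ρ(B)`, evaluated at the configuration `μ`. -/
def fluctuation {X : Type*} [MeasurableSpace X] (ρ : Measure X) (B : Set X) (t : ℝ)
    (μ : Measure X) (j : ℕ+) : ℝ :=
  ((multCount B μ j : ℝ) - t ^ (j : ℕ) * ρ.real B / ((j : ℕ) : ℝ)) / √(ρ.real B)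

end

/-! Started from `Y 0 = 0`, the process at time `t` is a Pólya sum process with parameters `t` and
`ρ`. For such a process the multiplicity counts `U(j)` in a bounded set `B` are exactly independent
Poisson variables with parameters `t^j ρ(B) / j`, so only a Poisson central limit theorem remains.

The exact law comes from the Campbell equation. Adding a point at an atom of mass `k` turns one atom
of mass `k` into one of mass `k + 1`. Testing on atoms of mass `k + 1` therefore expresses `(k + 1)
E[U(k + 1) f(U)]` through atoms of mass `k` (`IsPolyaSumProcess.lintegral_multCount_mul`). For `k =
0` only the diffuse measure `ρ` contributes; for `k ≥ 1` only `μ` does. Induction gives `j E[U(j)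
f(U)] = z^j ρ(B) E[f(U + e_j)]`, and these Chen-Stein equations force independent Poisson laws
(`eq_infinitePi_poissonMeasure`).

As `ρ(B_n) → ∞`, each normalized coordinate converges by `tendsto_normalizedPoisson`. Since the laws
are products for every `n`, `tendsto_infinitePi` upgrades this to joint convergence with independent
limits. -/

/-! ### Weak convergence of countable products. -/

/-- The product of a family of probability measures, as a probability measure. -/
noncomputable def MeasureTheory.ProbabilityMeasure.infinitePi {ι : Type*} {α : ι → Type*}
    [∀ i, MeasurableSpace (α i)] (μ : ∀ i, ProbabilityMeasure (α i)) :
    ProbabilityMeasure (∀ i, α i) :=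
  ⟨Measure.infinitePi fun i ↦ (μ i : Measure (α i)), inferInstance⟩

theorem MeasureTheory.ProbabilityMeasure.infinitePi_pi {ι : Type*} {α : ι → Type*}
    [∀ i, MeasurableSpace (α i)] (μ : ∀ i, ProbabilityMeasure (α i)) {I : Finset ι}
    {s : ∀ i, Set (α i)} (hs : ∀ i, MeasurableSet (s i)) :
    infinitePi μ ((I : Set ι).pi s) = ∏ i ∈ I, μ i (s i) := by
  rw [← ENNReal.coe_inj]
  simp only [ennreal_coeFn_eq_coeFn_toMeasure, ENNReal.ofNNReal_finsetProd]
  exact Measure.infinitePi_pi _ fun i _ ↦ hs i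

/-- Coordinatewise weak convergence of probability measures implies weak convergence of the
countable products. -/
theorem tendsto_infinitePi {ι κ : Type*} [Countable ι] {α : ι → Type*}
    [∀ i, MeasurableSpace (α i)] [∀ i, PseudoMetricSpace (α i)]
    [∀ i, SecondCountableTopology (α i)] [∀ i, OpensMeasurableSpace (α i)]
    {l : Filter κ} [l.IsCountablyGenerated]
    {μ : κ → ∀ i, ProbabilityMeasure (α i)} {ν : ∀ i, ProbabilityMeasure (α i)}
    (h : ∀ i, Tendsto (fun n ↦ μ n i) l (𝓝 (ν i))) :
    Tendsto (fun n ↦ ProbabilityMeasure.infinitePi (μ n)) l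
      (𝓝 (ProbabilityMeasure.infinitePi ν)) := by
  classical
  -- Finite-dimensional boxes with continuity sets as sides form a convergence-determining π-system.
  -- Requiring full sides outside `I` lets boxes over different index sets be intersected side by
  -- side.
  let S : Set (Set (∀ i, α i)) := {t | ∃ (I : Finset ι) (s : ∀ i, Set (α i)),
    t = (I : Set ι).pi s ∧ (∀ i, i ∉ I → s i = Set.univ) ∧
    (∀ i, MeasurableSet (s i)) ∧ (∀ i, (ν i : Measure (α i)) (frontier (s i)) = 0)}
  have key : ∀ (I : Finset ι) (s : ∀ i, Set (α i)), (∀ i, i ∉ I → s i = Set.univ) →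
      (I : Set ι).pi s = Set.univ.pi s := by
    intro I s hs
    ext x
    simp only [Set.mem_pi, Finset.mem_coe, Set.mem_univ, true_implies]
    refine ⟨fun hx i ↦ ?_, fun hx i _ ↦ hx i⟩
    by_cases hi : i ∈ I
    · exact hx i hi
    · rw [hs i hi]; trivial
  have hS : IsPiSystem S := by
    rintro - ⟨I, s, rfl, hs, smeas, sν⟩ - ⟨I', s', rfl, hs', smeas', sν'⟩ -
    have hu : ∀ i, i ∉ I ∪ I' → s i ∩ s' i = Set.univ := fun i hi ↦ by
      rw [Finset.notMem_union] at hi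
      rw [hs i hi.1, hs' i hi.2, Set.inter_univ]
    refine ⟨I ∪ I', fun i ↦ s i ∩ s' i, ?_, hu, fun i ↦ (smeas i).inter (smeas' i),
      fun i ↦ null_frontier_inter (sν i) (sν' i)⟩
    rw [key _ _ hs, key _ _ hs', key _ _ hu, Set.pi_inter_distrib]
  apply hS.tendsto_probabilityMeasure_of_tendsto_of_mem
  · rintro - ⟨I, s, rfl, -, smeas, -⟩
    exact MeasurableSet.pi I.countable_toSet fun i _ ↦ smeas i
  · intro u u_open x xu
    obtain ⟨I, v, hv, hvu⟩ := isOpen_pi_iff.1 u_open x xu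
    have A (i) : ∃ r : ℝ, 0 < r ∧ (i ∈ I → Metric.ball (x i) r ⊆ v i) ∧
        (ν i : Measure (α i)) (frontier (Metric.ball (x i) r)) = 0 := by
      obtain ⟨ε, εpos, hε⟩ : ∃ ε > 0, i ∈ I → Metric.ball (x i) ε ⊆ v i := by
        by_cases hi : i ∈ I
        · obtain ⟨ε, hε, h⟩ := Metric.isOpen_iff.1 (hv i hi).1 _ (hv i hi).2
          exact ⟨ε, hε, fun _ ↦ h⟩
        · exact ⟨1, one_pos, fun h ↦ absurd h hi⟩
      obtain ⟨r, hr, hr'⟩ := exists_null_frontier_thickening (ν i : Measure (α i)) {x i} εpos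
      exact ⟨r, hr.1, fun hi ↦ (Metric.ball_subset_ball hr.2.le).trans (hε hi), by simpa using hr'⟩
    choose r rpos hr hrν using A
    refine ⟨_, ⟨I, fun i ↦ if i ∈ I then Metric.ball (x i) (r i) else Set.univ, rfl,
      fun i hi ↦ if_neg hi, fun i ↦ ?_, fun i ↦ ?_⟩, ?_, ?_⟩
    · dsimp only
      split_ifs
      exacts [Metric.isOpen_ball.measurableSet, .univ]
    · dsimp only
      split_ifs
      exacts [hrν i, by simp]
    · refine (isOpen_set_pi I.finite_toSet fun i hi ↦ ?_).mem_nhds fun i hi ↦ ?_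
      · rw [if_pos (Finset.mem_coe.1 hi)]; exact Metric.isOpen_ball
      · rw [if_pos (Finset.mem_coe.1 hi)]; exact Metric.mem_ball_self (rpos i)
    · refine fun y hy ↦ hvu fun i hi ↦ ?_
      have := hy i hi
      simp only [if_pos (Finset.mem_coe.1 hi)] at this
      exact hr i hi this
  · rintro - ⟨I, s, rfl, -, smeas, sν⟩
    simp only [ProbabilityMeasure.infinitePi_pi _ smeas]
    refine tendsto_finsetProd _ fun i _ ↦ ?_
    refine ProbabilityMeasure.tendsto_measure_of_null_frontier_of_tendsto (h i) ?_
    rw [ProbabilityMeasure.null_iff_toMeasure_null]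
    exact sν i

/-! ### Central limit theorem for Poisson variables. -/

/-- With `x = u / √r` one has `r x² = u²`, so the left side is `r` times the third-order Taylor
remainder of `exp (i x)`, of size at most `r |x|³ = |u|³ / √r`. -/
theorem norm_mul_exp_sub_add_le {r u : ℝ} (hr : 0 < r) (hur : |u| ≤ √r) :
    ‖(r : ℂ) * (Complex.exp ((u / √r : ℝ) * Complex.I) - 1 - (u / √r : ℝ) * Complex.I)
      + (u : ℂ) ^ 2 / 2‖ ≤ |u| ^ 3 / √r := by
  have hs : 0 < √r := Real.sqrt_pos.2 hr
  set x : ℝ := u / √r with hx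
  have hxr : r * x ^ 2 = u ^ 2 := by
    rw [hx, div_pow, Real.sq_sqrt hr.le]; field_simp
  have hn : ‖(x : ℂ) * Complex.I‖ = |u| / √r := by
    simp [hx, abs_of_pos hs]
  have h1 : ‖(x : ℂ) * Complex.I‖ ≤ 1 := by
    rw [hn]; exact div_le_one_of_le₀ hur hs.le
  have hb := Complex.exp_bound h1 (n := 3) (by norm_num)
  have e : (r : ℂ) * (Complex.exp (x * Complex.I) - 1 - x * Complex.I) + (u : ℂ) ^ 2 / 2
      = r * (Complex.exp (x * Complex.I)
        - ∑ m ∈ Finset.range 3, ((x : ℂ) * Complex.I) ^ m / m.factorial) := by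
    have : (u : ℂ) ^ 2 = r * x ^ 2 := by exact_mod_cast hxr.symm
    rw [this]
    simp [Finset.sum_range_succ, mul_pow]
    ring
  rw [e, norm_mul, Complex.norm_real, Real.norm_of_nonneg hr.le]
  calc r * _ ≤ r * (‖(x : ℂ) * Complex.I‖ ^ 3 * 1) := by
        refine mul_le_mul_of_nonneg_left (hb.trans ?_) hr.le
        refine mul_le_mul_of_nonneg_left ?_ (by positivity)
        norm_num [Nat.factorial]
    _ = |u| ^ 3 / √r := by
        rw [hn, mul_one, div_pow]
        have : r = √r ^ 2 := (Real.sq_sqrt hr.le).symm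
        nth_rewrite 1 [this]
        field_simp

/-- The law of a Poisson variable with parameter `c * r`, centred and divided by `√r`. -/
noncomputable def normalizedPoisson (c r : ℝ≥0) : ProbabilityMeasure ℝ :=
  ⟨(poissonMeasure (c * r)).map (fun k : ℕ ↦ ((k : ℝ) - c * r) / √r),
    Measure.isProbabilityMeasure_map Measurable.of_discrete.aemeasurable⟩

theorem charFun_normalizedPoisson (c r : ℝ≥0) (u : ℝ) :
    charFun (normalizedPoisson c r : Measure ℝ) u = Complex.exp (c * ((r : ℝ) *
      (Complex.exp ((u / √(r : ℝ) : ℝ) * Complex.I) - 1 - (u / √(r : ℝ) : ℝ) * Complex.I))) := by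
  have e : (normalizedPoisson c r : Measure ℝ) =
      (((poissonMeasure (c * r)).map (Nat.cast : ℕ → ℝ)).map ((√(r : ℝ))⁻¹ * ·)).map
        (· + (-(c * r / √(r : ℝ)))) := by
    rw [Measure.map_map (by fun_prop) (by fun_prop), Measure.map_map (by fun_prop) (by fun_prop)]
    change Measure.map _ _ = _
    congr 1
    ext k
    simp only [Function.comp]
    ring
  rw [e, charFun_map_add_const, charFun_map_mul, charFun_map_cast_poissonMeasure,
    ← Complex.exp_add]
  congr 1
  simp only [Real.inner_apply]
  push_cast
  ring_nf

/-- Central limit theorem for Poisson variables with parameters tending to infinity. -/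
theorem tendsto_normalizedPoisson (c : ℝ≥0) {r : ℕ → ℝ≥0} (hr : Tendsto r atTop atTop) :
    Tendsto (fun n ↦ normalizedPoisson c (r n)) atTop (𝓝 ⟨gaussianReal 0 c, inferInstance⟩) := by
  refine ProbabilityMeasure.tendsto_of_tendsto_charFun fun u ↦ ?_
  simp only [charFun_normalizedPoisson]
  have hg : charFun (gaussianReal 0 c) u = Complex.exp (c * (-((u : ℂ) ^ 2 / 2))) := by
    rw [charFun_gaussianReal]
    congr 1
    simp
    ring
  change Tendsto _ _ (𝓝 (charFun (gaussianReal 0 c) u))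
  rw [hg]
  refine (Complex.continuous_exp.tendsto _).comp (Tendsto.const_mul _ ?_)
  have hs : Tendsto (fun n ↦ √(r n : ℝ)) atTop atTop :=
    Real.tendsto_sqrt_atTop.comp (NNReal.tendsto_coe_atTop.2 hr)
  rw [tendsto_iff_norm_sub_tendsto_zero]
  refine squeeze_zero' (Eventually.of_forall fun n ↦ norm_nonneg _) ?_
    (hs.const_div_atTop (|u| ^ 3))
  filter_upwards [hs.eventually_ge_atTop |u|, hs.eventually_gt_atTop 0] with n hn hn'
  rw [sub_neg_eq_add]
  exact norm_mul_exp_sub_add_le (Real.sqrt_pos.1 hn') hn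

/-! ### Chen-Stein characterization of independent Poisson families. -/

/-- Testing the equation on `{m j = k + 1}` gives the Poisson recursion in `k` for the `g`-weighted
mass of `{m j = k}`, because `g` ignores coordinate `j`. The recursion fixes these masses up to a
factor, which summation over `k` identifies as the integral of `g`. -/
theorem lintegral_indicator_eq_poisson_mul {ι : Type*} [DecidableEq ι] {N : Measure (ι → ℕ)}
    {j : ι} {l : ℝ≥0}
    (h : ∀ f : (ι → ℕ) → ℝ≥0∞, Measurable f →
      ∫⁻ m, (m j : ℝ≥0∞) * f m ∂N = l * ∫⁻ m, f (m + Pi.single j 1) ∂N)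
    {g : (ι → ℕ) → ℝ≥0∞} (hg : Measurable g) (hgj : ∀ m, g (m + Pi.single j 1) = g m)
    (A : Set ℕ) :
    ∫⁻ m, A.indicator 1 (m j) * g m ∂N = poissonMeasure l A * ∫⁻ m, g m ∂N := by
  set a : ℕ → ℝ≥0∞ := fun k ↦ ∫⁻ m, ({k} : Set ℕ).indicator 1 (m j) * g m ∂N with ha
  have hmeas : ∀ A : Set ℕ, Measurable fun m : ι → ℕ ↦ A.indicator (1 : ℕ → ℝ≥0∞) (m j) * g m :=
    by
    intro A
    have h1 : Measurable (A.indicator (1 : ℕ → ℝ≥0∞)) := .of_discrete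
    exact (h1.comp (measurable_pi_apply j)).mul hg
  have hsum : ∀ A : Set ℕ, ∫⁻ m, A.indicator 1 (m j) * g m ∂N = ∑' k, A.indicator a k := by
    intro A
    have : ∀ m : ι → ℕ, A.indicator (1 : ℕ → ℝ≥0∞) (m j) * g m =
        ∑' k, A.indicator (1 : ℕ → ℝ≥0∞) k * (({k} : Set ℕ).indicator 1 (m j) * g m) := by
      intro m
      rw [tsum_eq_single (m j)]
      · simp
      · intro k hk
        simp [Set.indicator, hk.symm]
    simp_rw [this]
    rw [lintegral_tsum fun k ↦ ((hmeas _).const_mul _).aemeasurable]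
    refine tsum_congr fun k ↦ ?_
    rw [lintegral_const_mul _ (hmeas _)]
    by_cases hk : k ∈ A <;> simp [hk, ha]
  have hstep : ∀ k : ℕ, ((k : ℝ≥0∞) + 1) * a (k + 1) = l * a k := by
    intro k
    have := h _ (hmeas {k + 1})
    rw [ha]
    simp only
    rw [← lintegral_const_mul _ (hmeas _)]
    convert this using 2
    · ext m
      by_cases hm : m j = k + 1 <;> simp [hm]
    · congr 1
      ext m
      simp [hgj, Set.indicator]
  -- The factor `exp l * a 0` is forced by `k = 0`, where the Poisson weight is `exp (-l)`.
  have hpo : ∀ k, poissonMeasure l {k} * (ENNReal.ofReal (Real.exp l) * a 0) = a k := by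
    intro k
    induction k with
    | zero =>
      rw [poissonMeasure_singleton, ← mul_assoc, ← ENNReal.ofReal_mul (by positivity)]
      simp [← Real.exp_add]
    | succ k ih =>
      have h1 : ((k : ℝ≥0∞) + 1) * poissonMeasure l {k + 1} = l * poissonMeasure l {k} := by
        rw [poissonMeasure_singleton, poissonMeasure_singleton,
          ← ENNReal.ofReal_coe_nnreal, ← ENNReal.ofReal_mul (by positivity)]
        have : (k : ℝ≥0∞) + 1 = ENNReal.ofReal (k + 1) := by
          rw [ENNReal.ofReal_add (by positivity) (by positivity)]; simp
        rw [this, ← ENNReal.ofReal_mul (by positivity), Nat.factorial_succ]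
        congr 1
        push_cast
        field_simp
        ring
      have h0 : ((k : ℝ≥0∞) + 1) ≠ 0 := by positivity
      have h2 : ((k : ℝ≥0∞) + 1) ≠ ∞ := by finiteness
      rw [← ENNReal.mul_right_inj h0 h2, hstep, ← ih, ← mul_assoc, h1, mul_assoc]
  have htot : ∫⁻ m, g m ∂N = ENNReal.ofReal (Real.exp l) * a 0 := by
    have h1 := hsum Set.univ
    simp only [Set.indicator_univ, Pi.one_apply, one_mul] at h1
    rw [h1]
    rw [← tsum_congr hpo, ENNReal.tsum_mul_right]
    have := Measure.tsum_indicator_apply_singleton (poissonMeasure l) Set.univ .univ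
    simp only [Set.indicator_univ, measure_univ] at this
    rw [this, one_mul]
  rw [hsum, htot, ← Measure.tsum_indicator_apply_singleton _ A .of_discrete,
    ← ENNReal.tsum_mul_right]
  refine tsum_congr fun k ↦ ?_
  classical
  rw [Set.indicator_apply, Set.indicator_apply]
  split_ifs
  · rw [← hpo]
  · rw [zero_mul]

/-- The Chen-Stein equations characterize families of independent Poisson variables. -/
theorem eq_infinitePi_poissonMeasure {ι : Type*} [DecidableEq ι] {N : Measure (ι → ℕ)}
    [IsProbabilityMeasure N] {l : ι → ℝ≥0}
    (h : ∀ j, ∀ f : (ι → ℕ) → ℝ≥0∞, Measurable f →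
      ∫⁻ m, (m j : ℝ≥0∞) * f m ∂N = l j * ∫⁻ m, f (m + Pi.single j 1) ∂N) :
    N = Measure.infinitePi fun j ↦ poissonMeasure (l j) := by
  refine Measure.eq_infinitePi _ fun s t ht ↦ ?_
  induction s using Finset.induction_on with
  | empty => simp
  | insert j s hj ih =>
    have hm : MeasurableSet ((s : Set ι).pi t) := .pi s.countable_toSet fun i _ ↦ ht i
    have hm' : MeasurableSet (((insert j s : Finset ι) : Set ι).pi t) :=
      .pi (Finset.countable_toSet _) fun i _ ↦ ht i
    -- Coordinate `j` is split off with `g` the indicator of the box over `s`, which does not depend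
    -- on `m j` since `j ∉ s`.
    rw [Finset.prod_insert hj, ← ih, ← lintegral_indicator_one hm, ← lintegral_indicator_one hm',
      ← lintegral_indicator_eq_poisson_mul (h j) (measurable_one.indicator hm)]
    · refine lintegral_congr fun m ↦ ?_
      by_cases h1 : m j ∈ t j <;> by_cases h2 : m ∈ (s : Set ι).pi t <;>
        simp [Set.indicator, Set.insert_pi, h1, h2]
    · intro m
      have : m + Pi.single j 1 ∈ (s : Set ι).pi t ↔ m ∈ (s : Set ι).pi t := by
        refine forall₂_congr fun i hi ↦ ?_
        have : i ≠ j := fun e ↦ hj (e ▸ hi)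
        simp [this]
      by_cases hs : m ∈ (s : Set ι).pi t
      · rw [Set.indicator_of_mem hs, Set.indicator_of_mem (this.2 hs)]; simp
      · rw [Set.indicator_of_notMem hs, Set.indicator_of_notMem (mt this.1 hs)]

/-! ### Measurability of atoms and of multiplicity counts. -/

section PartitionCells

variable {X : Type*} [MeasurableSpace X] [MeasurableSpace.CountablyGenerated X]

open MeasurableSpace

theorem antitone_countablePartitionSet (x : X) : Antitone fun n ↦ countablePartitionSet n x := by
  refine antitone_nat_of_succ_le fun n ↦ ?_
  have h := countablePartitionSet_mem (n + 1) x
  have hx := mem_countablePartitionSet (n + 1) x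
  rw [countablePartition, memPartition_succ] at h
  obtain ⟨u, hu, h | h⟩ := h
  · rw [countablePartitionSet_of_mem hu (h ▸ hx : x ∈ u ∩ _).1, h]
    exact Set.inter_subset_left
  · rw [countablePartitionSet_of_mem hu (h ▸ hx : x ∈ u \ _).1, h]
    exact Set.sdiff_subset

/-- The cells generate the σ-field, so a point sharing every cell with `x` cannot be separated from
`x` by a measurable set, in particular not by `{x}`. -/
theorem iInter_countablePartitionSet [MeasurableSingletonClass X] (x : X) :
    ⋂ n, countablePartitionSet n x = {x} := by
  refine Set.Subset.antisymm (fun y hy ↦ ?_) ?_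
  · have h : ∀ s : Set X, MeasurableSet s → (x ∈ s ↔ y ∈ s) := by
      intro s hs
      rw [← generateFrom_iUnion_countablePartition X] at hs
      induction s, hs using generateFrom_induction with
      | hC s hs _ =>
        obtain ⟨n, hn⟩ := Set.mem_iUnion.1 hs
        rw [← countablePartitionSet_eq_iff x hn, ← countablePartitionSet_eq_iff y hn]
        rw [countablePartitionSet_of_mem (countablePartitionSet_mem n x) (Set.mem_iInter.1 hy n)]
      | empty => simp
      | compl s _ ih => simp [ih]
      | iUnion s _ ih => simp [ih]
    exact (h {x} (measurableSet_singleton x)).1 rfl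
  · rintro y rfl
    exact Set.mem_iInter.2 fun n ↦ mem_countablePartitionSet n _

/-- A jointly measurable version of `(x, μ) ↦ μ {x}` for `x ∈ B` and `μ B < ∞`. -/
noncomputable def atomMass (B : Set X) (x : X) (μ : Measure X) : ℝ≥0∞ :=
  ⨅ n, μ (B ∩ countablePartitionSet n x)

/-- At each level the partition is finite, so the mass of the cell around `x` is a finite sum of
products of a function of `x` and a function of `μ`. -/
theorem measurable_atomMass {B : Set X} (hB : MeasurableSet B) :
    Measurable fun p : X × Measure X ↦ atomMass B p.1 p.2 := by
  classical
  refine Measurable.iInf fun n ↦ ?_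
  have e : (fun p : X × Measure X ↦ p.2 (B ∩ countablePartitionSet n p.1)) = fun p ↦
      ∑ A ∈ (finite_countablePartition X n).toFinset,
        (A ×ˢ Set.univ).indicator (fun q : X × Measure X ↦ q.2 (B ∩ A)) p := by
    ext p
    rw [Finset.sum_eq_single (countablePartitionSet n p.1)]
    · rw [Set.indicator_of_mem]
      exact ⟨mem_countablePartitionSet n _, trivial⟩
    · intro A hA hne
      refine Set.indicator_of_notMem (fun h ↦ hne ?_) _
      exact (countablePartitionSet_of_mem ((Set.Finite.mem_toFinset _).1 hA) h.1).symm
    · intro h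
      exact absurd ((Set.Finite.mem_toFinset _).2 (countablePartitionSet_mem n _)) h
  rw [e]
  refine Finset.measurable_sum _ fun A hA ↦ ?_
  have hA' := measurableSet_countablePartition n ((Set.Finite.mem_toFinset _).1 hA)
  exact ((Measure.measurable_coe (hB.inter hA')).comp measurable_snd).indicator
    (hA'.prod .univ)

/-- The cells decrease to `{x}`; finiteness on `B` allows continuity from above. -/
theorem atomMass_eq [MeasurableSingletonClass X] {B : Set X}
    {μ : Measure X} (hμ : μ B ≠ ∞) {x : X} (hx : x ∈ B) : atomMass B x μ = μ {x} := by
  have h := (antitone_countablePartitionSet x).measure_iInter (μ := μ.restrict B)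
    (fun n ↦ (measurableSet_countablePartitionSet n x).nullMeasurableSet)
    ⟨0, ((measure_mono (Set.subset_univ _)).trans_lt
      (by rwa [Measure.restrict_apply_univ, lt_top_iff_ne_top])).ne⟩
  rw [iInter_countablePartitionSet, Measure.restrict_apply (measurableSet_singleton x),
    Set.inter_eq_left.2 (Set.singleton_subset_iff.2 hx)] at h
  rw [h, atomMass]
  refine iInf_congr fun n ↦ ?_
  rw [Measure.restrict_apply (measurableSet_countablePartitionSet n x), Set.inter_comm]

/-- The points of `B` which are atoms of `μ` of mass `k`. -/
def atomSet (B : Set X) (μ : Measure X) (k : ℕ) : Set X := {x | x ∈ B ∧ μ {x} = k}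

variable [MeasurableSingletonClass X] {B : Set X} {μ : Measure X}

theorem measurableSet_atomSet (hB : MeasurableSet B) (hμ : μ B ≠ ∞) (k : ℕ) :
    MeasurableSet (atomSet B μ k) := by
  have e : atomSet B μ k = B ∩ {x | atomMass B x μ = k} := by
    ext x
    exact and_congr_right fun hx ↦ by rw [Set.mem_ofPred_eq, atomMass_eq hμ hx]
  rw [e]
  exact hB.inter ((measurable_atomMass hB).of_uncurry_right (measurableSet_singleton _))

omit [MeasurableSpace.CountablyGenerated X] in
theorem finite_atomSet (hμ : μ B ≠ ∞) {k : ℕ} (hk : k ≠ 0) : (atomSet B μ k).Finite := by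
  have h := Measure.finite_const_le_meas_of_disjoint_iUnion (μ.restrict B) (ε := 1) one_pos
    (As := fun x : X ↦ {x}) (fun x ↦ measurableSet_singleton x)
    (fun x y hxy ↦ by simpa using hxy)
    (by simpa [Set.iUnion_of_singleton] using hμ)
  refine h.subset fun x hx ↦ ?_
  rw [Set.mem_ofPred_eq, Measure.restrict_apply (measurableSet_singleton x),
    Set.inter_eq_left.2 (Set.singleton_subset_iff.2 hx.1), hx.2]
  exact_mod_cast Nat.one_le_iff_ne_zero.2 hk

omit [MeasurableSpace.CountablyGenerated X] in
theorem measure_atomSet (hμ : μ B ≠ ∞) {k : ℕ} (hk : k ≠ 0) :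
    μ (atomSet B μ k) = k * (atomSet B μ k).ncard := by
  have hf := finite_atomSet hμ hk
  rw [← hf.coe_toFinset, ← sum_measure_singleton,
    Finset.sum_congr rfl fun x hx ↦ (hf.mem_toFinset.1 hx).2, Finset.sum_const, nsmul_eq_mul,
    mul_comm, Set.ncard_coe_finset]

/-- `multCount` agrees with a measurable function on the measures which are finite on `B`. -/
theorem exists_measurable_eq_multCount (hB : MeasurableSet B) :
    ∃ M : Measure X → ℕ+ → ℕ, Measurable M ∧ ∀ μ, μ B ≠ ∞ → M μ = multCount B μ := by
  -- Dividing by `μ B` bounds the total mass by 1 uniformly in `μ`, giving a finite kernel, for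
  -- which integration over sections is measurable. Multiplying back by `μ B` undoes this when `μ B`
  -- is finite.
  let κ : Kernel (Measure X) X := ⟨fun μ ↦ (μ B)⁻¹ • μ.restrict B, by
    refine Measure.measurable_of_measurable_coe _ fun s hs ↦ ?_
    simp only [Measure.smul_apply, Measure.restrict_apply hs, smul_eq_mul]
    exact (Measure.measurable_coe hB).inv.mul (Measure.measurable_coe (hs.inter hB))⟩
  have : IsFiniteKernel κ := ⟨⟨1, ENNReal.one_lt_top, fun μ ↦ by
    change ((μ B)⁻¹ • μ.restrict B) Set.univ ≤ 1
    simp [ENNReal.inv_mul_le_one]⟩⟩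
  have hS : ∀ j : ℕ+, MeasurableSet {p : Measure X × X | p.2 ∈ B ∧ atomMass B p.2 p.1 = (j : ℕ)} :=
    fun j ↦ (measurable_snd hB).inter
      ((measurable_atomMass hB).comp measurable_swap (measurableSet_singleton _))
  -- The atoms of mass `j` carry total mass `j` times their number; dividing by `j` recovers the
  -- count, and the floor only makes it a natural number.
  refine ⟨fun μ j ↦ ⌊(μ B * κ μ (Prod.mk μ ⁻¹'
    {p : Measure X × X | p.2 ∈ B ∧ atomMass B p.2 p.1 = (j : ℕ)}) / (j : ℕ)).toReal⌋₊,
    measurable_pi_lambda _ fun j ↦ ?_, fun μ hμ ↦ funext fun j ↦ ?_⟩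
  · exact (((Measure.measurable_coe hB).mul
      (Kernel.measurable_kernel_prodMk_left (hS j))).div_const _).ennreal_toReal.nat_floor
  · have e : Prod.mk μ ⁻¹' {p : Measure X × X | p.2 ∈ B ∧ atomMass B p.2 p.1 = (j : ℕ)}
        = atomSet B μ j := by
      ext x
      exact and_congr_right fun hx ↦ by rw [atomMass_eq hμ hx]
    have hm : μ B * κ μ (atomSet B μ j) = μ (atomSet B μ j) := by
      have hle : atomSet B μ j ⊆ B := fun x hx ↦ hx.1
      change μ B * ((μ B)⁻¹ * μ.restrict B _) = _
      rw [Measure.restrict_apply (measurableSet_atomSet hB hμ j), Set.inter_eq_left.2 hle]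
      rcases eq_or_ne (μ B) 0 with h0 | h0
      · rw [h0, zero_mul, measure_mono_null hle h0]
      · rw [← mul_assoc, ENNReal.mul_inv_cancel h0 hμ, one_mul]
    simp only [e]
    rw [hm, measure_atomSet hμ j.ne_zero, mul_comm, ENNReal.mul_div_cancel_right (by simp)
      (by simp)]
    simp [multCount, atomSet]

end PartitionCells

/-! ### Atoms of point measures and the effect of adding a point. -/

section PointMeasures

variable {X : Type*} [MetricSpace X] [SecondCountableTopology X] [MeasurableSpace X]
  [BorelSpace X] {B : Set X} {μ : Measure X}

omit [SecondCountableTopology X] [BorelSpace X] in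
theorem IsPointMeasure.isBoundedlyFinite (hμ : IsPointMeasure μ) : IsBoundedlyFinite μ := by
  intro B hB hB'
  obtain ⟨n, hn⟩ := hμ B hB hB'
  rw [hn]
  exact ENNReal.natCast_lt_top n

omit [SecondCountableTopology X] in
theorem IsPointMeasure.exists_singleton_eq (hμ : IsPointMeasure μ) (x : X) :
    ∃ n : ℕ, μ {x} = n :=
  hμ {x} (measurableSet_singleton x) Bornology.isBounded_singleton

omit [SecondCountableTopology X] [BorelSpace X] in
theorem IsPointMeasure.add_dirac (hμ : IsPointMeasure μ) (x : X) :
    IsPointMeasure (μ + Measure.dirac x) := by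
  classical
  intro B hB hB'
  obtain ⟨n, hn⟩ := hμ B hB hB'
  refine ⟨n + if x ∈ B then 1 else 0, ?_⟩
  rw [Measure.add_apply, hn, Measure.dirac_apply' x hB]
  by_cases hx : x ∈ B <;> simp [hx]

/-- A locally finite point measure is purely atomic. -/
theorem IsPointMeasure.measure_atomSet_zero (hμ : IsPointMeasure μ) (hB : MeasurableSet B)
    (hB' : Bornology.IsBounded B) : μ (atomSet B μ 0) = 0 := by
  have hfin : μ B ≠ ∞ := (hμ.isBoundedlyFinite B hB hB').ne
  -- A non-atom of `μ` lies in some cell of mass less than 1, hence of mass 0 by integrality. There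
  -- are only countably many such null cells.
  let S : ℕ → Set (Set X) := fun n ↦
    {A | A ∈ MeasurableSpace.countablePartition X n ∧ μ (B ∩ A) = 0}
  have hS : ∀ n, (S n).Countable := fun n ↦
    ((MeasurableSpace.finite_countablePartition X n).subset fun A hA ↦ hA.1).countable
  refine measure_mono_null (t := ⋃ n, ⋃ A ∈ S n, B ∩ A) (fun x hx ↦ ?_)
    (measure_iUnion_null fun n ↦ (measure_biUnion_null_iff (hS n)).2 fun A hA ↦ hA.2)
  have h0 : atomMass B x μ < 1 := by
    rw [atomMass_eq hfin hx.1, hx.2]; simp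
  obtain ⟨n, hn⟩ := iInf_lt_iff.1 h0
  refine Set.mem_iUnion.2 ⟨n, Set.mem_biUnion
    ⟨MeasurableSpace.countablePartitionSet_mem n x, ?_⟩
    ⟨hx.1, MeasurableSpace.mem_countablePartitionSet n x⟩⟩
  obtain ⟨m, hm⟩ := hμ _ (hB.inter (MeasurableSpace.measurableSet_countablePartitionSet n x))
    (hB'.subset Set.inter_subset_left)
  rw [hm] at hn ⊢
  have : m < 1 := by exact_mod_cast hn
  simp [Nat.lt_one_iff.1 this]

omit [SecondCountableTopology X] in
theorem measure_atomSet_eq_zero_of_diffuse {ρ : Measure X} (hρ : ∀ x, ρ {x} = 0)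
    (hfin : μ B ≠ ∞) {k : ℕ} (hk : k ≠ 0) : ρ (atomSet B μ k) = 0 := by
  have : NullSingletonClass ρ := ⟨hρ⟩
  exact (finite_atomSet hfin hk).measure_zero ρ

-- The rest of `B` is a countable union of finite sets of atoms of `μ`, which the diffuse measure
-- `ρ` does not charge.
omit [SecondCountableTopology X] in
theorem IsPointMeasure.measure_atomSet_zero_of_diffuse {ρ : Measure X} (hρ : ∀ x, ρ {x} = 0)
    (hμ : IsPointMeasure μ) (hfin : μ B ≠ ∞) : ρ (atomSet B μ 0) = ρ B := by
  refine measure_congr (ae_eq_set.2 ⟨?_, ?_⟩)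
  · rw [Set.sdiff_eq_empty.2 fun x hx ↦ hx.1, measure_empty]
  · refine measure_mono_null (t := ⋃ k : ℕ, atomSet B μ (k + 1)) (fun x hx ↦ ?_)
      (measure_iUnion_null fun k ↦ measure_atomSet_eq_zero_of_diffuse hρ hfin k.succ_ne_zero)
    obtain ⟨n, hn⟩ := hμ.exists_singleton_eq x
    cases n with
    | zero => exact absurd ⟨hx.1, hn⟩ hx.2
    | succ k => exact Set.mem_iUnion.2 ⟨k, hx.1, hn⟩

omit [SecondCountableTopology X] in
theorem atomSet_add_dirac {x : X} {k : ℕ} (hx : x ∈ atomSet B μ k) (i : ℕ) :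
    atomSet B (μ + Measure.dirac x) i =
      if i = k + 1 then insert x (atomSet B μ i) else if i = k then atomSet B μ i \ {x}
      else atomSet B μ i := by
  classical
  have hself : (μ + Measure.dirac x) {x} = ((k + 1 : ℕ) : ℝ≥0∞) := by
    simp [hx.2]
  have hne : ∀ y, y ≠ x → (μ + Measure.dirac x) {y} = μ {y} := by
    intro y hy
    simp [Measure.dirac_apply' x (measurableSet_singleton y), hy.symm]
  ext y
  rcases eq_or_ne y x with rfl | hy
  · have h1 : y ∈ atomSet B (μ + Measure.dirac y) i ↔ i = k + 1 := by
      rw [atomSet, Set.mem_ofPred_eq, hself]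
      refine ⟨fun h ↦ (Nat.cast_injective h.2).symm, fun h ↦ ⟨hx.1, by rw [h]⟩⟩
    have h2 : y ∈ atomSet B μ i ↔ i = k := by
      rw [atomSet, Set.mem_ofPred_eq, hx.2]
      refine ⟨fun h ↦ (Nat.cast_injective h.2).symm, fun h ↦ ⟨hx.1, by rw [h]⟩⟩
    rw [h1]
    split_ifs with h3 h4 <;> simp [*]
  · have h1 : y ∈ atomSet B (μ + Measure.dirac x) i ↔ y ∈ atomSet B μ i := by
      simp only [atomSet, Set.mem_ofPred_eq, hne y hy]
    rw [h1]
    split_ifs <;> simp [hy]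

/-- The change of the multiplicity counts when an atom of mass `k` gets mass `k + 1`. -/
def raiseMult (k : ℕ) (m : ℕ+ → ℕ) : ℕ+ → ℕ := fun i ↦
  if (i : ℕ) = k + 1 then m i + 1 else if (i : ℕ) = k then m i - 1 else m i

theorem measurable_raiseMult (k : ℕ) : Measurable (raiseMult k) := by
  refine measurable_pi_lambda _ fun i ↦ ?_
  unfold raiseMult
  split_ifs <;> fun_prop

omit [SecondCountableTopology X] in
theorem multCount_add_dirac (hfin : μ B ≠ ∞) {x : X} {k : ℕ} (hx : x ∈ atomSet B μ k) :
    multCount B (μ + Measure.dirac x) = raiseMult k (multCount B μ) := by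
  ext i
  change (atomSet B (μ + Measure.dirac x) i).ncard = _
  have hi := finite_atomSet hfin i.ne_zero
  rw [atomSet_add_dirac hx]
  unfold raiseMult
  split_ifs with h1 h2
  · refine Set.ncard_insert_of_notMem (fun h ↦ ?_) hi
    have : (i : ℝ≥0∞) = k := h.2.symm.trans hx.2
    have : (i : ℕ) = k := by exact_mod_cast this
    omega
  · refine Set.ncard_sdiff_singleton_of_mem ?_
    rwa [h2]
  · rfl

/-- An atom of mass `k` is first created and then raised, so the truncated subtraction is harmless.
This identity drives the induction on multiplicity. -/
theorem raiseMult_add_single (k : ℕ+) (m : ℕ+ → ℕ) :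
    raiseMult k (m + Pi.single k 1) = m + Pi.single (k + 1) 1 := by
  ext i
  simp only [raiseMult, Pi.add_apply, Pi.single_apply, ← PNat.coe_inj, PNat.add_coe, PNat.one_coe]
  split_ifs <;> omega

theorem raiseMult_zero (m : ℕ+ → ℕ) : raiseMult 0 m = m + Pi.single 1 1 := by
  ext i
  -- Index 0 does not occur in `ℕ+`, so raising from mass 0 decrements no count.
  have := i.pos
  simp only [raiseMult, Pi.add_apply, Pi.single_apply, ← PNat.coe_inj, PNat.one_coe]
  split_ifs <;> omega

end PointMeasures

/-! ### Multiplicity counts of a Pólya sum process. -/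

section PolyaSum

variable {X : Type*} [MetricSpace X] [SecondCountableTopology X] [MeasurableSpace X]
  [BorelSpace X] {B : Set X} {ρ : Measure X} {z : ℝ} {Q : Measure (Measure X)}

/-- This is the Campbell equation for `h(x, μ) = 1{x ∈ B, μ{x} = k + 1} f(U(μ))`. On the right, `μ +
δ_x` has mass `k + 1` at `x` exactly when `μ` has mass `k` there, and the counts then change by
`raiseMult k`. -/
theorem IsPolyaSumProcess.lintegral_multCount_mul (hQ : IsPolyaSumProcess z ρ Q)
    (hB : MeasurableSet B) (hB' : Bornology.IsBounded B) (k : ℕ) {f : (ℕ+ → ℕ) → ℝ≥0∞}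
    (hf : Measurable f) :
    ∫⁻ μ, ((k + 1 : ℕ) : ℝ≥0∞) * multCount B μ k.succPNat * f (multCount B μ) ∂Q =
      ∫⁻ μ, ENNReal.ofReal z * (ρ (atomSet B μ k) + μ (atomSet B μ k)) *
        f (raiseMult k (multCount B μ)) ∂Q := by
  obtain ⟨M, hM, hMB⟩ := exists_measurable_eq_multCount hB
  let S : Set (X × Measure X) := {p | p.1 ∈ B ∧ atomMass B p.1 p.2 = ((k + 1 : ℕ) : ℝ≥0∞)}
  have hS : MeasurableSet S :=
    (measurable_fst hB).inter (measurable_atomMass hB (measurableSet_singleton _))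
  have key := hQ.campbell (S.indicator fun p ↦ f (M p.2))
    ((hf.comp (hM.comp measurable_snd)).indicator hS)
  have hfin : ∀ μ : Measure X, IsPointMeasure μ → μ B ≠ ∞ := fun μ hμ ↦
    (hμ.isBoundedlyFinite B hB hB').ne
  have hl : ∀ᵐ μ ∂Q, ∫⁻ x, S.indicator (fun p ↦ f (M p.2)) (x, μ) ∂μ =
      ((k + 1 : ℕ) : ℝ≥0∞) * multCount B μ k.succPNat * f (multCount B μ) := by
    filter_upwards [hQ.ae_isPointMeasure] with μ hμ
    have e : (fun x ↦ S.indicator (fun p ↦ f (M p.2)) (x, μ)) =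
        (atomSet B μ (k + 1)).indicator fun _ ↦ f (multCount B μ) := by
      ext x
      have : (x, μ) ∈ S ↔ x ∈ atomSet B μ (k + 1) :=
        and_congr_right fun hx ↦ by simp only [atomMass_eq (hfin μ hμ) hx]
      by_cases hx : (x, μ) ∈ S
      · rw [Set.indicator_of_mem hx, Set.indicator_of_mem (this.1 hx), hMB μ (hfin μ hμ)]
      · rw [Set.indicator_of_notMem hx, Set.indicator_of_notMem (mt this.2 hx)]
    rw [e, lintegral_indicator_const (measurableSet_atomSet hB (hfin μ hμ) _), mul_comm,
      measure_atomSet (hfin μ hμ) k.succ_ne_zero]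
    rfl
  have hr : ∀ᵐ μ ∂Q, ∫⁻ x, S.indicator (fun p ↦ f (M p.2)) (x, μ + Measure.dirac x)
        ∂(ENNReal.ofReal z • (ρ + μ)) =
      ENNReal.ofReal z * (ρ (atomSet B μ k) + μ (atomSet B μ k)) *
        f (raiseMult k (multCount B μ)) := by
    filter_upwards [hQ.ae_isPointMeasure] with μ hμ
    have e : (fun x ↦ S.indicator (fun p ↦ f (M p.2)) (x, μ + Measure.dirac x)) =
        (atomSet B μ k).indicator fun _ ↦ f (raiseMult k (multCount B μ)) := by
      ext x
      have hfin' := hfin _ (hμ.add_dirac x)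
      have : (x, μ + Measure.dirac x) ∈ S ↔ x ∈ atomSet B μ k := by
        refine and_congr_right fun hx ↦ ?_
        simp only [atomMass_eq hfin' hx]
        obtain ⟨n, hn⟩ := hμ.exists_singleton_eq x
        have : (μ + Measure.dirac x) {x} = ((n + 1 : ℕ) : ℝ≥0∞) := by simp [hn]
        rw [this, hn, Nat.cast_inj, Nat.cast_inj, Nat.add_right_cancel_iff]
      by_cases hx : (x, μ + Measure.dirac x) ∈ S
      · rw [Set.indicator_of_mem hx, Set.indicator_of_mem (this.1 hx), hMB _ hfin',
          multCount_add_dirac (hfin μ hμ) (this.1 hx)]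
      · rw [Set.indicator_of_notMem hx, Set.indicator_of_notMem (mt this.2 hx)]
    rw [e, lintegral_indicator_const (measurableSet_atomSet hB (hfin μ hμ) _), mul_comm,
      Measure.smul_apply, Measure.add_apply, smul_eq_mul]
  rw [← lintegral_congr_ae hl, key, lintegral_congr_ae hr]

/-- The Chen-Stein equations for the multiplicity counts of a Pólya sum process. -/
theorem IsPolyaSumProcess.lintegral_multCount_mul_eq (hQ : IsPolyaSumProcess z ρ Q)
    (hz : 0 ≤ z) (hρ : ∀ x, ρ {x} = 0) (hB : MeasurableSet B) (hB' : Bornology.IsBounded B)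
    (j : ℕ+) : ∀ f : (ℕ+ → ℕ) → ℝ≥0∞, Measurable f →
    ∫⁻ μ, (j : ℕ) * multCount B μ j * f (multCount B μ) ∂Q =
      ENNReal.ofReal (z ^ (j : ℕ)) * ρ B * ∫⁻ μ, f (multCount B μ + Pi.single j 1) ∂Q := by
  obtain ⟨M, hM, hMB⟩ := exists_measurable_eq_multCount hB
  have hfin : ∀ μ : Measure X, IsPointMeasure μ → μ B ≠ ∞ := fun μ hμ ↦
    (hμ.isBoundedlyFinite B hB hB').ne
  have hM' : AEMeasurable (fun μ ↦ multCount B μ) Q := ⟨M, hM, by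
    filter_upwards [hQ.ae_isPointMeasure] with μ hμ using (hMB μ (hfin μ hμ)).symm⟩
  induction j using PNat.recOn with
  | one =>
    intro f hf
    have h := hQ.lintegral_multCount_mul hB hB' 0 hf
    change ∫⁻ μ, ((1 : ℕ) : ℝ≥0∞) * multCount B μ 1 * f (multCount B μ) ∂Q = _ at h
    have hm : AEMeasurable (fun μ ↦ f (multCount B μ + Pi.single 1 1)) Q :=
      hf.comp_aemeasurable (hM'.add_const _)
    rw [← lintegral_const_mul'' _ hm]
    refine h.trans ?_
    refine lintegral_congr_ae ?_
    filter_upwards [hQ.ae_isPointMeasure] with μ hμ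
    -- Points of mass 0 carry all of `ρ` on `B` and nothing of `μ`.
    rw [hμ.measure_atomSet_zero_of_diffuse hρ (hfin μ hμ), hμ.measure_atomSet_zero hB hB',
      raiseMult_zero]
    simp
  | succ k ih =>
    intro f hf
    have h := hQ.lintegral_multCount_mul hB hB' k hf
    -- The induction hypothesis is applied to `f ∘ raiseMult k`, turning the shift by `e_k` into a
    -- shift by `e_{k+1}`.
    have h2 := ih _ (hf.comp (measurable_raiseMult k))
    simp only [Function.comp, raiseMult_add_single] at h2
    have e : (k : ℕ).succPNat = k + 1 := by
      rw [← PNat.coe_inj]; simp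
    rw [e] at h
    rw [PNat.add_coe, PNat.one_coe, pow_succ', ENNReal.ofReal_mul hz, mul_assoc, mul_assoc,
      ← mul_assoc (ENNReal.ofReal (z ^ _)), ← h2, h, ← lintegral_const_mul'']
    · refine lintegral_congr_ae ?_
      filter_upwards [hQ.ae_isPointMeasure] with μ hμ
      -- For `k ≥ 1` the roles reverse: the finitely many atoms are `ρ`-null and carry `μ`-mass `k
      -- U(k)`.
      rw [measure_atomSet_eq_zero_of_diffuse hρ (hfin μ hμ) k.ne_zero,
        measure_atomSet (hfin μ hμ) k.ne_zero, zero_add, mul_assoc]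
      rfl
    · refine AEMeasurable.mul (AEMeasurable.const_mul ?_ _)
        ((hf.comp (measurable_raiseMult k)).comp_aemeasurable hM')
      exact (Measurable.of_discrete (f := fun n : ℕ ↦ (n : ℝ≥0∞))).comp_aemeasurable
        ((measurable_pi_apply k).comp_aemeasurable hM')

/-- The multiplicity counts of a Pólya sum process with diffuse reference measure are independent
Poisson variables. -/
theorem IsPolyaSumProcess.map_multCount (hQ : IsPolyaSumProcess z ρ Q)
    (hz : 0 ≤ z) (hρ : ∀ x, ρ {x} = 0) (hB : MeasurableSet B) (hB' : Bornology.IsBounded B)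
    (hρB : ρ B ≠ ∞) :
    Q.map (fun μ ↦ multCount B μ) =
      Measure.infinitePi fun j : ℕ+ ↦
        poissonMeasure ((z ^ (j : ℕ) / (j : ℕ)).toNNReal * (ρ B).toNNReal) := by
  obtain ⟨M, hM, hMB⟩ := exists_measurable_eq_multCount hB
  have hM' : AEMeasurable (fun μ ↦ multCount B μ) Q := ⟨M, hM, by
    filter_upwards [hQ.ae_isPointMeasure] with μ hμ using
      (hMB μ (hμ.isBoundedlyFinite B hB hB').ne).symm⟩
  have := hQ.isProbabilityMeasure
  have := Measure.isProbabilityMeasure_map (μ := Q) hM'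
  refine eq_infinitePi_poissonMeasure fun j f hf ↦ ?_
  have hm : Measurable fun m : ℕ+ → ℕ ↦ (m j : ℝ≥0∞) * f m :=
    ((Measurable.of_discrete (f := fun n : ℕ ↦ (n : ℝ≥0∞))).comp (measurable_pi_apply j)).mul hf
  rw [lintegral_map' hm.aemeasurable hM', lintegral_map' (by fun_prop) hM']
  have hj0 : ((j : ℕ) : ℝ≥0∞) ≠ 0 := by simp
  have hj1 : ((j : ℕ) : ℝ≥0∞) ≠ ∞ := by simp
  have h := hQ.lintegral_multCount_mul_eq hz hρ hB hB' j f hf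
  have hm' : AEMeasurable (fun μ ↦ (multCount B μ j : ℝ≥0∞) * f (multCount B μ)) Q :=
    hm.comp_aemeasurable hM'
  have hc : ((j : ℕ) : ℝ≥0∞) * ENNReal.ofReal (z ^ (j : ℕ) / (j : ℕ)) =
      ENNReal.ofReal (z ^ (j : ℕ)) := by
    rw [← ENNReal.ofReal_natCast, ← ENNReal.ofReal_mul (by positivity)]
    congr 1
    field_simp
  rw [← ENNReal.mul_right_inj hj0 hj1, ← lintegral_const_mul'' _ hm', ENNReal.coe_mul,
    ENNReal.coe_toNNReal hρB, ← mul_assoc, ← mul_assoc]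
  change _ = (j : ℕ) * ENNReal.ofReal (z ^ (j : ℕ) / (j : ℕ)) * ρ B * _
  rw [hc, ← h]
  simp only [mul_assoc]

end PolyaSum

/-! ### One-dimensional laws of the spatial process. -/

section SpatialCRP

variable {X Ω : Type*} [MetricSpace X] [MeasurableSpace X] [MeasurableSpace Ω] {P : Measure Ω}
  {ρ : Measure X} {Y : Set.Ico (0 : ℝ) 1 → Ω → Measure X}

theorem isPointMeasure_zero : IsPointMeasure (0 : Measure X) :=
  fun B _ _ ↦ ⟨0, by simp⟩

/-- The one-dimensional laws of the spatial process are Pólya sum processes. -/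
theorem IsSpatialCRP.isPolyaSumProcess_map [IsProbabilityMeasure P] (hY : IsSpatialCRP ρ P Y)
    {t : Set.Ico (0 : ℝ) 1} (ht : 0 < (t : ℝ)) : IsPolyaSumProcess t ρ (P.map (Y t)) := by
  -- From time 0 the parameter `(t - s) / (1 - s)` is `t`, and `Y 0 = 0` almost surely makes the
  -- conditional law deterministic.
  obtain ⟨κ, hκ, h⟩ := hY.markov 0 t ht
  have h0 := hκ 0 isPointMeasure_zero
  have e : ((t : ℝ) - (0 : Set.Ico (0 : ℝ) 1)) / (1 - (0 : Set.Ico (0 : ℝ) 1)) = t := by simp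
  rw [e, add_zero] at h0
  convert h0
  ext s hs
  rw [Measure.map_apply (hY.measurable t) hs]
  have h1 := h Set.univ MeasurableSet.univ (s.indicator 1) (measurable_one.indicator hs)
  rw [Measure.restrict_univ] at h1
  have h2 : ∫⁻ ω, ∫⁻ μ, s.indicator 1 (Y 0 ω + μ) ∂(κ (Y 0 ω)) ∂P = ∫⁻ _, κ 0 s ∂P := by
    refine lintegral_congr_ae ?_
    filter_upwards [hY.init] with ω hω
    simp only [hω, zero_add]
    exact lintegral_indicator_one hs
  rw [h2, lintegral_const, measure_univ, mul_one] at h1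
  rw [← h1, ← lintegral_indicator_one (hY.measurable t hs)]
  rfl

variable [SecondCountableTopology X] [BorelSpace X]

theorem IsSpatialCRP.measurable_multCount (hY : IsSpatialCRP ρ P Y) {B : Set X}
    (hB : MeasurableSet B) (hB' : Bornology.IsBounded B) (t : Set.Ico (0 : ℝ) 1) :
    Measurable fun ω ↦ multCount B (Y t ω) := by
  obtain ⟨M, hM, hMB⟩ := exists_measurable_eq_multCount hB
  have e : (fun ω ↦ multCount B (Y t ω)) = fun ω ↦ M (Y t ω) := funext fun ω ↦
    (hMB _ (((hY.path ω).isPointMeasure t).isBoundedlyFinite B hB hB').ne).symm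
  rw [e]
  exact hM.comp (hY.measurable t)

/-- Centring and scaling act coordinate by coordinate, so they carry the product of Poisson laws to
a product of normalized ones. -/
theorem IsSpatialCRP.map_fluctuation [IsProbabilityMeasure P] (hY : IsSpatialCRP ρ P Y) (hρ : ∀ x, ρ {x} = 0) {B : Set X}
    (hB : MeasurableSet B) (hB' : Bornology.IsBounded B) (hρB : ρ B ≠ ∞)
    {t : Set.Ico (0 : ℝ) 1} (ht : 0 < (t : ℝ)) :
    P.map (fun ω (j : ℕ+) ↦ fluctuation ρ B t (Y t ω) j) =
      ProbabilityMeasure.infinitePi fun j : ℕ+ ↦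
        normalizedPoisson ((t : ℝ) ^ (j : ℕ) / (j : ℕ)).toNNReal (ρ B).toNNReal := by
  obtain ⟨M, hM, hMB⟩ := exists_measurable_eq_multCount hB
  have hQ := hY.isPolyaSumProcess_map ht
  have hlaw := hQ.map_multCount ht.le hρ hB hB' hρB
  have hM' : AEMeasurable (fun μ ↦ multCount B μ) (P.map (Y t)) := ⟨M, hM, by
    filter_upwards [hQ.ae_isPointMeasure] with μ hμ using
      (hMB μ (hμ.isBoundedlyFinite B hB hB').ne).symm⟩
  rw [AEMeasurable.map_map_of_aemeasurable hM' (hY.measurable t).aemeasurable] at hlaw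
  have e : (fun ω (j : ℕ+) ↦ fluctuation ρ B t (Y t ω) j) =
      (fun (m : ℕ+ → ℕ) (j : ℕ+) ↦ ((m j : ℝ) -
        ((t : ℝ) ^ (j : ℕ) / (j : ℕ)).toNNReal * (ρ B).toNNReal) / √((ρ B).toNNReal : ℝ)) ∘
      (fun ω ↦ multCount B (Y t ω)) := by
    ext ω j
    have hc : 0 ≤ (t : ℝ) ^ (j : ℕ) / (j : ℕ) := by positivity
    simp only [fluctuation, Function.comp, Real.coe_toNNReal _ hc, ENNReal.coe_toNNReal_eq_toReal,
      Measure.real]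
    ring_nf
  have hmeas : ∀ j : ℕ+, Measurable fun k : ℕ ↦ ((k : ℝ) -
      ((t : ℝ) ^ (j : ℕ) / (j : ℕ)).toNNReal * (ρ B).toNNReal) / √((ρ B).toNNReal : ℝ) :=
    fun j ↦ .of_discrete
  have hmeas' : Measurable fun (m : ℕ+ → ℕ) (j : ℕ+) ↦ ((m j : ℝ) -
      ((t : ℝ) ^ (j : ℕ) / (j : ℕ)).toNNReal * (ρ B).toNNReal) / √((ρ B).toNNReal : ℝ) :=
    measurable_pi_lambda _ fun j ↦ (hmeas j).comp (measurable_pi_apply j)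
  rw [e, ← Measure.map_map hmeas' (hY.measurable_multCount hB hB' t)]
  change P.map (fun ω ↦ multCount B (Y t ω)) = _ at hlaw
  rw [hlaw, Measure.infinitePi_map_pi _ hmeas]
  rfl

end SpatialCRP

/-! ### Passage to the limit. -/

theorem tendsto_measure_toNNReal_atTop {X : Type*} [MeasurableSpace X] {ρ : Measure X}
    (hρ : ρ Set.univ = ∞) {B : ℕ → Set X} (hB : Monotone B) (hfin : ∀ n, ρ (B n) ≠ ∞)
    (hU : ⋃ n, B n = Set.univ) : Tendsto (fun n ↦ (ρ (B n)).toNNReal) atTop atTop := by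
  have h := tendsto_measure_iUnion_atTop (μ := ρ) hB
  rw [hU, hρ] at h
  rw [← ENNReal.tendsto_coe_nhds_top]
  refine h.congr fun n ↦ (ENNReal.coe_toNNReal (hfin n)).symm

theorem mainTheorem8 {X Ω : Type*}
    [MetricSpace X] [CompleteSpace X] [SecondCountableTopology X]
    [MeasurableSpace X] [BorelSpace X]
    [MeasurableSpace Ω] (P : Measure Ω) [IsProbabilityMeasure P]
    (ρ : Measure X) (hρ_fin : IsBoundedlyFinite ρ)
    (hρ_diffuse : ∀ x : X, ρ {x} = 0) (hρ_inf : ρ Set.univ = ∞)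
    (Y : Set.Ico (0 : ℝ) 1 → Ω → Measure X) (hY : IsSpatialCRP ρ P Y)
    (B : ℕ → Set X) (hB_meas : ∀ n, MeasurableSet (B n))
    (hB_bdd : ∀ n, Bornology.IsBounded (B n)) (hB_mono : Monotone B)
    (hB_exhaust : ⋃ n, B n = Set.univ)
    (t : Set.Ico (0 : ℝ) 1) (ht : 0 < (t : ℝ)) :
    ∃ (Ω' : Type) (_ : MeasurableSpace Ω') (P' : Measure Ω') (_ : IsProbabilityMeasure P')
      (Z : ℕ+ → Ω' → ℝ),
      (∀ j : ℕ+, HasLaw (Z j) (gaussianReal 0 (Real.toNNReal ((t : ℝ) ^ (j : ℕ) / (j : ℕ)))) P') ∧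
      (∀ j : ℕ+, TendstoInDistribution
        (fun n ω => fluctuation ρ (B n) t (Y t ω) j) atTop (Z j) (fun _ => P) P') ∧
      iIndepFun Z P' ∧
      TendstoInDistribution
        (fun n ω (j : ℕ+) => fluctuation ρ (B n) t (Y t ω) j) atTop
        (fun ω' (j : ℕ+) => Z j ω') (fun _ => P) P' := by
  have hfin : ∀ n, ρ (B n) ≠ ∞ := fun n ↦ (hρ_fin _ (hB_meas n) (hB_bdd n)).ne
  obtain ⟨Ω', mΩ', P', Z, hZm, hZ, hind, hP'⟩ := exists_hasLaw_indepFun (fun _ : ℕ+ ↦ ℝ)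
    (fun j : ℕ+ ↦ gaussianReal 0 (Real.toNNReal ((t : ℝ) ^ (j : ℕ) / (j : ℕ))))
  have hjoint : TendstoInDistribution
      (fun n ω (j : ℕ+) ↦ fluctuation ρ (B n) t (Y t ω) j) atTop
      (fun ω' (j : ℕ+) ↦ Z j ω') (fun _ ↦ P) P' := by
    refine ⟨fun n ↦ ?_, (measurable_pi_lambda _ hZm).aemeasurable, ?_⟩
    · refine (measurable_pi_lambda _ fun j ↦ ?_).aemeasurable
      have h := (measurable_pi_apply j).comp
        (hY.measurable_multCount (hB_meas n) (hB_bdd n) t)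
      exact (((Measurable.of_discrete (f := fun k : ℕ ↦ (k : ℝ))).comp h).sub_const _).div_const _
    · have hlim : P'.map (fun ω' (j : ℕ+) ↦ Z j ω') = ProbabilityMeasure.infinitePi
          fun j : ℕ+ ↦ (⟨gaussianReal 0 (Real.toNNReal ((t : ℝ) ^ (j : ℕ) / (j : ℕ))),
            inferInstance⟩ : ProbabilityMeasure ℝ) := by
        rw [hind.map_fun_eq_infinitePi_map hZm]
        simp only [(hZ _).map_eq]
        rfl
      have h := tendsto_infinitePi fun j : ℕ+ ↦
        tendsto_normalizedPoisson (Real.toNNReal ((t : ℝ) ^ (j : ℕ) / (j : ℕ)))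
          (tendsto_measure_toNNReal_atTop hρ_inf hB_mono hfin hB_exhaust)
      exact Tendsto.congr (fun n ↦ Subtype.ext
        (hY.map_fluctuation hρ_diffuse (hB_meas n) (hB_bdd n) (hfin n) ht).symm)
        (h.trans (congrArg (fun ν : ProbabilityMeasure (ℕ+ → ℝ) ↦ 𝓝 ν)
          (Subtype.ext hlim.symm)).le)
  -- Coordinate projections are continuous, so the marginal limits follow from the joint one.
  exact ⟨Ω', mΩ', P', hP', Z, hZ, fun j ↦ hjoint.continuous_comp (continuous_apply j), hind,
    hjoint⟩
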